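/- Theorem 1.3. Let $z, N \in \mathbb{R}$ with $N \le z$, and let $V(x) = z/|x|$ on $\mathbb{R}^3$. Let $u, \varphi : \mathbb{R}^3 \to \mathbb{R}$ be radial functions and $\omega \in \mathbb{R}$ such that $$u \in H^1(\mathbb{R}^3), \qquad \varphi \in \mathcal{D}^{1,2}(\mathbb{R}^3),$$ where $\mathcal{D}^{1,2}(\mathbb{R}^3)$ is the closure of $C_0^\infty(\mathbb{R}^3)$ in the norm $\left(\int_{\mathbb{R}^3} |\nabla \varphi|^2\,dx\right)^{1/2}$ (realized, by the Sobolev inequality, as a space of $L^6$ functions; so $\int_{\mathbb{R}^3}|\nabla\varphi|^2\,dx < \infty$ and $\varphi$ is normalized to vanish at infinity). Suppose that $(u, \varphi, \omega)$ is a solution of $$-\tfrac12 \Delta u - \varphi u - V(x) u = \omega u, \qquad \Delta \varphi = 4\pi u^2, \qquad \int_{\mathbb{R}^3} u^2\,dx = N,$$ where the two differential equations hold in the sense of distributions on $\mathbb{R}^3$, and that it is nontrivial, i.e. $u$ and $\varphi$ do not both vanish almost everywhere. Then $\omega < 0$. -/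

import Mathlib

open MeasureTheory Filter Topology
open scoped RealInnerProductSpace

namespace MaxwellSchrodinger

/-- The Euclidean space `ℝ³`. -/
abbrev E3 : Type := EuclideanSpace ℝ (Fin 3)

/-- `η ∈ C₀^∞(ℝ³)`, real valued. -/
def IsTest (η : E3 → ℝ) : Prop :=
  ContDiff ℝ (⊤ : ℕ∞) η ∧ HasCompactSupport η

/-- `G` is the weak (distributional) gradient of `u` on `ℝ³`: for every test function `η` and
every direction `v`, `∫ u ∂_v η = - ∫ ⟪G, v⟫ η`. -/
def HasWeakGradient (u : E3 → ℝ) (G : E3 → E3) : Prop :=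
  LocallyIntegrable u ∧ LocallyIntegrable G ∧
    ∀ η : E3 → ℝ, IsTest η → ∀ v : E3,
      ∫ x, u x * fderiv ℝ η x v = - ∫ x, ⟪G x, v⟫ * η x

/-- `u ∈ H¹(ℝ³)`, real valued: `u ∈ L²` with a weak gradient in `L²`. -/
def MemH1 (u : E3 → ℝ) : Prop :=
  MemLp u 2 ∧ ∃ G : E3 → E3, MemLp G 2 ∧ HasWeakGradient u G

/-- `φ ∈ 𝒟^{1,2}(ℝ³)`, the closure of `C₀^∞(ℝ³)` for the norm `(∫ |∇φ|²)^{1/2}`.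
By the Sobolev inequality `‖η‖_{L⁶} ≤ C ‖∇η‖_{L²}` on `C₀^∞(ℝ³)`, a sequence of test functions that
is Cauchy for this norm converges in `L⁶`; its limit `φ` there is the element of the closure, and
the limit `G` in `L²` of the gradients is `∇φ`. -/
def MemD12 (φ : E3 → ℝ) : Prop :=
  MemLp φ 6 ∧ ∃ G : E3 → E3, MemLp G 2 ∧
    ∃ η : ℕ → E3 → ℝ, (∀ n, IsTest (η n)) ∧
      Tendsto (fun n => eLpNorm (fun x => η n x - φ x) 6 volume) atTop (𝓝 0) ∧
      Tendsto (fun n => eLpNorm (fun x => gradient (η n) x - G x) 2 volume) atTop (𝓝 0)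

/-- `u` is radial: it agrees almost everywhere with a function of `|x|`. -/
def IsRadial (u : E3 → ℝ) : Prop :=
  ∃ f : ℝ → ℝ, ∀ᵐ x : E3, u x = f ‖x‖

/-- The nuclear potential `V(x) = z / |x|`. -/
noncomputable def coulomb (z : ℝ) (x : E3) : ℝ := z / ‖x‖

/-- `(u, φ, ω)` solves
`-½ Δu - φ u - V u = ω u`, `Δφ = 4π u²` in the sense of distributions on `ℝ³`, and `∫ u² = N`.
The first four fields say that every term is a distribution given by a locally integrable
function; they hold automatically for `u ∈ H¹`, `φ ∈ 𝒟^{1,2}` and `V = z/|x|`. -/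
structure IsSolution (V : E3 → ℝ) (N : ℝ) (u φ : E3 → ℝ) (ω : ℝ) : Prop where
  locallyIntegrable_phi : LocallyIntegrable φ
  locallyIntegrable_phi_mul : LocallyIntegrable (fun x => φ x * u x)
  locallyIntegrable_potential_mul : LocallyIntegrable (fun x => V x * u x)
  integrable_sq : Integrable (fun x => u x ^ 2)
  schrodinger : ∀ η : E3 → ℝ, IsTest η →
    -(1 / 2) * (∫ x, u x * Laplacian.laplacian η x) - (∫ x, φ x * u x * η x)
      - (∫ x, V x * u x * η x) = ω * ∫ x, u x * η x
  poisson : ∀ η : E3 → ℝ, IsTest η →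
    ∫ x, φ x * Laplacian.laplacian η x = 4 * Real.pi * ∫ x, u x ^ 2 * η x
  mass : ∫ x, u x ^ 2 = N

end MaxwellSchrodinger

/-!
Suppose `ω ≥ 0`. In radial coordinates `v(r) = r u(r)` solves `v'' = -q v` on `(0, ∞)` with
`q(r) = 2 (ω + φ(r) + z / r)`, and `∫ v² < ∞`. Newton's theorem gives `φ'(r) = m(r) / r²`, where
`m(r)` is the mass of `u²` inside the ball of radius `r`, so `q'(r) = 2 (m(r) - z) / r² ≤ 0` because
`m(r) ≤ N ≤ z`. Moreover `q ≥ 0`: otherwise `φ` would stay below a negative constant at infinity,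
against `φ ∈ L⁶`. An equation `v'' = -q v` with `q ≥ 0` nonincreasing has no nonzero square
integrable solution (`eq_zero_of_deriv_eq_of_sq_integrable`): its solutions oscillate with
nondecreasing amplitude or are eventually monotone and concave towards the axis. So `u = 0`, then
`φ` is constant, and `φ = 0` as `φ ∈ L⁶`, which contradicts nontriviality.

The passage from distributions on `ℝ³` to the half line is `ae_eq_of_laplacian_eq_radial`: a radial
distributional solution of `ΔF = P` is almost everywhere equal to a function with
`r² F'(r) = ∫₀ʳ P s² ds`. It uses test functions `η(x) = g(|x|)` constant near the origin with
prescribed `r² g'(r) = κ(r)`, for which `r² Δη = κ'`, and the du Bois-Reymond lemma.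
-/

namespace MaxwellSchrodinger

/-! ### A decreasing potential admits no square integrable solution -/

section ODE

open Set

/-- A square integrable function with bounded derivative tends to `0`: the derivative of `v ^ 3` is
integrable, so `v ^ 3` has a limit, which square integrability forces to be `0`. -/
theorem tendsto_zero_of_deriv_bounded_of_sq_integrable {v v' : ℝ → ℝ} {a K : ℝ}
    (hv : ∀ r ∈ Ici a, HasDerivAt v (v' r) r) (hv'c : ContinuousOn v' (Ici a))
    (hK : ∀ r ∈ Ici a, |v' r| ≤ K) (hint : IntegrableOn (fun r => v r ^ 2) (Ioi a)) :
    Tendsto v atTop (𝓝 0) := by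
  have hd : ∀ r ∈ Ioi a, HasDerivAt (fun r => v r ^ 3) (3 * v r ^ 2 * v' r) r := fun r hr => by
    simpa using (hv r (mem_Ici.2 (le_of_lt hr))).fun_pow 3
  have hvc : ContinuousOn v (Ioi a) := fun r hr =>
    (hv r (mem_Ici.2 (le_of_lt hr))).continuousAt.continuousWithinAt
  have hi : IntegrableOn (fun r => 3 * v r ^ 2 * v' r) (Ioi a) := by
    refine Integrable.mono' (hint.const_mul (3 * K)) ?_ ?_
    · exact (((hvc.pow 2).const_smul (3 : ℝ)).mul
        (hv'c.mono Ioi_subset_Ici_self)).aestronglyMeasurable measurableSet_Ioi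
    · filter_upwards [ae_restrict_mem measurableSet_Ioi] with r hr
      have := hK r (mem_Ici.2 (le_of_lt hr))
      rw [Real.norm_eq_abs, abs_mul, abs_of_nonneg (by positivity : (0 : ℝ) ≤ 3 * v r ^ 2)]
      nlinarith [sq_nonneg (v r)]
  have hlim := tendsto_limUnder_of_hasDerivAt_of_integrableOn_Ioi hd hi
  set L := limUnder atTop (fun r => v r ^ 3)
  rcases eq_or_ne L 0 with hL | hL
  · rw [hL] at hlim
    have h2 : Tendsto (fun r => |v r|) atTop (𝓝 0) := by
      have h3 := hlim.abs.rpow_const (p := (1 / 3 : ℝ)) (Or.inr (by norm_num))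
      simp only [abs_zero] at h3
      rw [Real.zero_rpow (by norm_num)] at h3
      refine h3.congr fun r => ?_
      rw [abs_pow, ← Real.rpow_natCast, ← Real.rpow_mul (abs_nonneg _)]
      norm_num
    exact (tendsto_zero_iff_abs_tendsto_zero _).2 h2
  · exfalso
    -- if `v ^ 3` has a nonzero limit, `v ^ 2` stays away from `0`
    have h2 : Tendsto (fun r => v r ^ 2) atTop (𝓝 (|L| ^ (2 / 3 : ℝ))) := by
      have h3 := hlim.abs.rpow_const (p := (2 / 3 : ℝ)) (Or.inr (by norm_num))
      refine h3.congr fun r => ?_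
      rw [abs_pow, ← Real.rpow_natCast, ← Real.rpow_mul (abs_nonneg _)]
      norm_num
    have hpos : 0 < |L| ^ (2 / 3 : ℝ) := by positivity
    have h3 : IntegrableAtFilter (fun r => v r ^ 2) atTop volume := ⟨Ioi a, Ioi_mem_atTop a, hint⟩
    refine hpos.ne' (h3.eq_zero_of_tendsto ?_ h2)
    intro s hs
    rcases mem_atTop_sets.1 hs with ⟨b, hb⟩
    rw [← top_le_iff, ← Real.volume_Ici (a := b)]
    exact measure_mono hb

/-- A solution of `v'' = -q v`, `q ≥ 0`, cannot decrease strictly to `0`: it would be positive,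
hence concave, hence below a line of negative slope. -/
theorem not_forall_deriv_neg_of_tendsto_zero {v v' q : ℝ → ℝ} {R : ℝ}
    (hv : ∀ r ∈ Ici R, HasDerivAt v (v' r) r)
    (hv' : ∀ r ∈ Ici R, HasDerivAt v' (-(q r * v r)) r)
    (hq : ∀ r ∈ Ici R, 0 ≤ q r) (hlim : Tendsto v atTop (𝓝 0)) :
    ¬ ∀ r ∈ Ici R, v' r < 0 := by
  intro hneg
  have hvc : ContinuousOn v (Ici R) := fun r hr => (hv r hr).continuousAt.continuousWithinAt
  have hv'c : ContinuousOn v' (Ici R) := fun r hr => (hv' r hr).continuousAt.continuousWithinAt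
  have hanti : AntitoneOn v (Ici R) := by
    refine antitoneOn_of_hasDerivWithinAt_nonpos (f' := v') (convex_Ici R) hvc ?_ ?_
    · intro r hr; exact (hv r (interior_subset hr)).hasDerivWithinAt
    · intro r hr; exact (hneg r (interior_subset hr)).le
  have hpos : ∀ r ∈ Ici R, 0 ≤ v r := by
    intro r hr
    refine le_of_tendsto hlim ?_
    filter_upwards [eventually_ge_atTop r] with s hs
    exact hanti hr (mem_Ici.2 (le_trans hr hs)) hs
  have hanti' : AntitoneOn v' (Ici R) := by
    refine antitoneOn_of_hasDerivWithinAt_nonpos (f' := fun r => -(q r * v r))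
      (convex_Ici R) hv'c ?_ ?_
    · intro r hr; exact (hv' r (interior_subset hr)).hasDerivWithinAt
    · intro r hr
      have h := interior_subset hr
      exact neg_nonpos.2 (mul_nonneg (hq r h) (hpos r h))
  have hlin : AntitoneOn (fun r => v r - v' R * r) (Ici R) := by
    refine antitoneOn_of_hasDerivWithinAt_nonpos (f' := fun r => v' r - v' R) (convex_Ici R)
      (hvc.sub (by fun_prop)) ?_ ?_
    · intro r hr
      simpa using ((hv r (interior_subset hr)).fun_sub
        ((hasDerivAt_id r).const_mul (v' R))).hasDerivWithinAt
    · intro r hr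
      exact sub_nonpos.2 (hanti' self_mem_Ici (interior_subset hr) (interior_subset hr))
  -- the tangent line of `v` at `R` is negative far out
  have hR := hneg R self_mem_Ici
  have h0 := hpos R self_mem_Ici
  set s := R + (v R + 1) / (-v' R) with hs
  have hge : R ≤ s := by
    have : 0 ≤ (v R + 1) / (-v' R) := div_nonneg (by linarith) (by linarith)
    linarith
  have h1 := hlin self_mem_Ici (mem_Ici.2 hge) hge
  have h2 := hpos s hge
  have h3 : v' R * s = v' R * R - (v R + 1) := by
    rw [hs]; field_simp [hR.ne]; ring
  simp only [h3] at h1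
  linarith

/-- If `q ≥ 0` is nonincreasing, then `v'' = -q v` has no nonzero square integrable solution on the
half line. The energy `v' ^ 2 + q v ^ 2` is nonincreasing, so `v'` is bounded and `v → 0`. The
amplitude `v ^ 2 + v' ^ 2 / q` is nondecreasing, so `v ^ 2` is bounded below at critical points far
out; hence there are none there, and `v` is eventually monotone, against concavity. If `q` vanishes
somewhere, then `v` is affine from there on, hence zero, and uniqueness propagates this back. -/
theorem eq_zero_of_deriv_eq_of_sq_integrable {v v' q q' : ℝ → ℝ}
    (hv : ∀ r ∈ Ioi (0 : ℝ), HasDerivAt v (v' r) r)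
    (hv' : ∀ r ∈ Ioi (0 : ℝ), HasDerivAt v' (-(q r * v r)) r)
    (hq : ∀ r ∈ Ioi (0 : ℝ), HasDerivAt q (q' r) r)
    (hq' : ∀ r ∈ Ioi (0 : ℝ), q' r ≤ 0) (hq0 : ∀ r ∈ Ioi (0 : ℝ), 0 ≤ q r)
    (hint : IntegrableOn (fun r => v r ^ 2) (Ioi 0)) :
    ∀ r ∈ Ioi (0 : ℝ), v r = 0 := by
  have hvc : ContinuousOn v (Ioi 0) := fun r hr => (hv r hr).continuousAt.continuousWithinAt
  have hv'c : ContinuousOn v' (Ioi 0) := fun r hr => (hv' r hr).continuousAt.continuousWithinAt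
  have hqc : ContinuousOn q (Ioi 0) := fun r hr => (hq r hr).continuousAt.continuousWithinAt
  have hqanti : AntitoneOn q (Ioi 0) := by
    refine antitoneOn_of_hasDerivWithinAt_nonpos (f' := q') (convex_Ioi 0) hqc ?_ ?_
    · intro r hr; exact (hq r (interior_subset hr)).hasDerivWithinAt
    · intro r hr; exact hq' r (interior_subset hr)
  -- the energy is nonincreasing, which bounds `v'` on `[1, ∞)`
  have hE : AntitoneOn (fun r => v' r ^ 2 + q r * v r ^ 2) (Ioi 0) := by
    refine antitoneOn_of_hasDerivWithinAt_nonpos (f' := fun r => q' r * v r ^ 2) (convex_Ioi 0)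
      ((hv'c.pow 2).add (hqc.mul (hvc.pow 2))) ?_ ?_
    · intro r hr
      have hr := interior_subset hr
      refine HasDerivAt.hasDerivWithinAt ?_
      convert! ((hv' r hr).fun_pow 2).fun_add ((hq r hr).fun_mul ((hv r hr).fun_pow 2)) using 1
      push_cast; ring
    · intro r hr
      exact mul_nonpos_of_nonpos_of_nonneg (hq' r (interior_subset hr)) (sq_nonneg _)
  have hlim : Tendsto v atTop (𝓝 0) := by
    have hsub : Ici (1 : ℝ) ⊆ Ioi 0 := fun r (hr : (1 : ℝ) ≤ r) => lt_of_lt_of_le one_pos hr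
    refine tendsto_zero_of_deriv_bounded_of_sq_integrable (a := 1) (v' := v')
      (K := √(v' 1 ^ 2 + q 1 * v 1 ^ 2))
      (fun r hr => hv r (hsub hr)) (hv'c.mono hsub) ?_
      (hint.mono_set (Ioi_subset_Ioi zero_le_one))
    intro r hr
    refine Real.abs_le_sqrt ?_
    have := hE (hsub self_mem_Ici) (hsub hr) hr
    have h2 := mul_nonneg (hq0 r (hsub hr)) (sq_nonneg (v r))
    simp only at this
    linarith
  by_contra! hne
  obtain ⟨r₀, hr₀, hvr₀⟩ := hne
  by_cases hz : ∃ r₁ ∈ Ioi (0 : ℝ), q r₁ = 0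
  · obtain ⟨r₁, hr₁, hqr₁⟩ := hz
    -- beyond `r₁` the potential vanishes and `v` is affine, hence zero
    have hsub : Ici r₁ ⊆ Ioi 0 := fun r hr => lt_of_lt_of_le (mem_Ioi.1 hr₁) hr
    have hq1 : ∀ r ∈ Ici r₁, q r = 0 := fun r hr =>
      le_antisymm (hqr₁ ▸ hqanti hr₁ (hsub hr) hr) (hq0 r (hsub hr))
    have hconst : ∀ r ∈ Ici r₁, v' r = v' r₁ := by
      intro r hr
      refine constant_of_has_deriv_right_zero (a := r₁) (b := r)
        (hv'c.mono fun x hx => hsub hx.1) ?_ r ⟨hr, le_rfl⟩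
      intro x hx
      simpa [hq1 x hx.1] using (hv' x (hsub hx.1)).hasDerivWithinAt (s := Ici x)
    have haff : ∀ r ∈ Ici r₁, v r - v' r₁ * r = v r₁ - v' r₁ * r₁ := by
      intro r hr
      refine constant_of_has_deriv_right_zero (f := fun r => v r - v' r₁ * r) (a := r₁) (b := r)
        ((hvc.mono fun x hx => hsub hx.1).sub (by fun_prop)) ?_ r ⟨hr, le_rfl⟩
      intro x hx
      simpa [hconst x hx.1] using ((hv x (hsub hx.1)).fun_sub
        ((hasDerivAt_id x).const_mul (v' r₁))).hasDerivWithinAt (s := Ici x)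
    have hv'r₁ : v' r₁ = 0 := by
      have h1 : Tendsto (fun r : ℝ => v r * r⁻¹ - (v r₁ - v' r₁ * r₁) * r⁻¹) atTop (𝓝 0) := by
        simpa using (hlim.mul tendsto_inv_atTop_zero).sub
          (tendsto_inv_atTop_zero.const_mul (v r₁ - v' r₁ * r₁))
      refine tendsto_nhds_unique (tendsto_const_nhds.congr' ?_) h1
      filter_upwards [eventually_ge_atTop r₁] with r hr
      have : r ≠ 0 := (hsub hr).ne'
      have := haff r hr
      field_simp
      linarith
    have hvr : ∀ r ∈ Ici r₁, v r = v r₁ := fun r hr => by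
      have := haff r hr
      simpa [hv'r₁] using this
    have hvr₁ : v r₁ = 0 := by
      refine tendsto_nhds_unique (tendsto_const_nhds.congr' ?_) hlim
      filter_upwards [eventually_ge_atTop r₁] with r hr using (hvr r hr).symm
    rcases le_total r₁ r₀ with h | h
    · exact hvr₀ ((hvr r₀ h).trans hvr₁)
    -- Gronwall backwards from `r₁`
    set M := 1 + q r₀ with hM
    have hsub' : Icc r₀ r₁ ⊆ Ioi 0 := fun r hr => lt_of_lt_of_le (mem_Ioi.1 hr₀) hr.1
    have hmono : MonotoneOn (fun r => Real.exp (M * r) * (v r ^ 2 + v' r ^ 2)) (Icc r₀ r₁) := by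
      refine monotoneOn_of_hasDerivWithinAt_nonneg
        (f' := fun r => Real.exp (M * r) * (M * (v r ^ 2 + v' r ^ 2)
          + 2 * (1 - q r) * (v r * v' r))) (convex_Icc r₀ r₁)
        (ContinuousOn.mul (by fun_prop)
          (((hvc.mono hsub').pow 2).add ((hv'c.mono hsub').pow 2))) ?_ ?_
      · intro r hr
        have hr := hsub' (interior_subset hr)
        refine HasDerivAt.hasDerivWithinAt ?_
        convert! (((hasDerivAt_id r).const_mul M).exp).fun_mul
          (((hv r hr).fun_pow 2).fun_add ((hv' r hr).fun_pow 2)) using 1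
        simp; ring
      · intro r hr
        have hr := interior_subset hr
        have h1 := hqanti hr₀ (hsub' hr) hr.1
        have h2 := hq0 r (hsub' hr)
        refine mul_nonneg (Real.exp_pos _).le ?_
        nlinarith [mul_nonneg h2 (sq_nonneg (v r - v' r)), sq_nonneg (v r + v' r),
          mul_nonneg (sub_nonneg.2 h1) (add_nonneg (sq_nonneg (v r)) (sq_nonneg (v' r)))]
    have h1 := hmono ⟨le_rfl, h⟩ ⟨h, le_rfl⟩ h
    simp only [hvr₁, hv'r₁] at h1
    have h2 : 0 < v r₀ ^ 2 + v' r₀ ^ 2 := by positivity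
    have h3 := mul_pos (Real.exp_pos (M * r₀)) h2
    norm_num at h1
    linarith
  · push Not at hz
    have hmono : MonotoneOn (fun r => v r ^ 2 + v' r ^ 2 / q r) (Ioi 0) := by
      refine monotoneOn_of_hasDerivWithinAt_nonneg
        (f' := fun r => -q' r * v' r ^ 2 / q r ^ 2) (convex_Ioi 0)
        ((hvc.pow 2).add ((hv'c.pow 2).div hqc hz)) ?_ ?_
      · intro r hr
        have hr := interior_subset hr
        have := hz r hr
        refine HasDerivAt.hasDerivWithinAt ?_
        convert! ((hv r hr).fun_pow 2).fun_add
          (((hv' r hr).fun_pow 2).fun_div (hq r hr) this) using 1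
        field_simp; ring
      · intro r hr
        have := hq' r (interior_subset hr)
        exact div_nonneg (mul_nonneg (by linarith) (sq_nonneg _)) (sq_nonneg _)
    -- at a critical point `v ^ 2` is at least `v r₀ ^ 2`, so there is none far out
    have hev : ∀ᶠ r in atTop, v r ^ 2 < v r₀ ^ 2 := by
      have h1 : Tendsto (fun r => v r ^ 2) atTop (𝓝 0) := by simpa using hlim.pow 2
      exact h1.eventually_lt_const (by positivity)
    obtain ⟨R, hR⟩ := eventually_atTop.1 (hev.and (eventually_ge_atTop r₀))
    have hsub : Ici R ⊆ Ioi 0 := fun r hr => lt_of_lt_of_le (mem_Ioi.1 hr₀) (hR r hr).2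
    have hcrit : ∀ r ∈ Ici R, v' r ≠ 0 := by
      intro r hr h0
      have h1 := hmono hr₀ (hsub hr) (hR r hr).2
      have h2 := (hR r hr).1
      have h3 : 0 ≤ v' r₀ ^ 2 / q r₀ := div_nonneg (sq_nonneg _) (hq0 r₀ hr₀)
      simp only [h0] at h1
      norm_num at h1
      linarith
    have hsign : (∀ r ∈ Ici R, v' r < 0) ∨ ∀ r ∈ Ici R, 0 < v' r := by
      by_contra! hcon
      obtain ⟨⟨a, ha, ha'⟩, b, hb, hb'⟩ := hcon
      obtain ⟨c, hc, hc'⟩ := (isPreconnected_Ici (a := R)).intermediate_value hb ha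
        (hv'c.mono hsub) ⟨hb', ha'⟩
      exact hcrit c hc hc'
    rcases hsign with hs | hs
    · exact not_forall_deriv_neg_of_tendsto_zero (fun r hr => hv r (hsub hr))
        (fun r hr => hv' r (hsub hr)) (fun r hr => hq0 r (hsub hr)) hlim hs
    · refine not_forall_deriv_neg_of_tendsto_zero (v := -v) (v' := -v') (q := q) (R := R)
        (fun r hr => (hv r (hsub hr)).neg) (fun r hr => ?_) (fun r hr => hq0 r (hsub hr))
        (by simpa using! hlim.neg) (fun r hr => by simpa using hs r hr)
      simpa using (hv' r (hsub hr)).neg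

end ODE
end MaxwellSchrodinger

namespace MaxwellSchrodinger

/-! ### Distributions on the half line -/

section HalfLine

open Set
open scoped ContDiff

/-- `κ ∈ C₀^∞(0, ∞)`, with its support enclosed in an explicit interval `[a, b]`, `0 < a < b`. -/
def IsHalfLineTest (κ : ℝ → ℝ) (a b : ℝ) : Prop :=
  ContDiff ℝ ∞ κ ∧ 0 < a ∧ a < b ∧ ∀ r ∉ Icc a b, κ r = 0

namespace IsHalfLineTest

variable {κ : ℝ → ℝ} {a b : ℝ}

theorem hasCompactSupport (h : IsHalfLineTest κ a b) : HasCompactSupport κ :=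
  HasCompactSupport.intro isCompact_Icc h.2.2.2

theorem integrable (h : IsHalfLineTest κ a b) : Integrable κ :=
  h.1.continuous.integrable_of_hasCompactSupport h.hasCompactSupport

theorem hasDerivAt (h : IsHalfLineTest κ a b) (r : ℝ) : HasDerivAt κ (deriv κ r) r :=
  ((h.1.differentiable (by simp)) r).hasDerivAt

theorem deriv (h : IsHalfLineTest κ a b) : IsHalfLineTest (deriv κ) a b := by
  refine ⟨h.1.deriv', h.2.1, h.2.2.1, fun r hr => ?_⟩
  have : κ =ᶠ[𝓝 r] fun _ => 0 := by
    filter_upwards [isClosed_Icc.isOpen_compl.mem_nhds hr] with x hx using h.2.2.2 x hx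
  simpa using this.deriv_eq

theorem setIntegral_mul (h : IsHalfLineTest κ a b) (w : ℝ → ℝ) :
    ∫ r in Ioi 0, w r * κ r = ∫ r, w r * κ r := by
  refine setIntegral_eq_integral_of_forall_compl_eq_zero fun r hr => ?_
  rw [h.2.2.2 r fun h' => hr (lt_of_lt_of_le h.2.1 h'.1), mul_zero]

theorem integrable_mul (h : IsHalfLineTest κ a b) {w : ℝ → ℝ}
    (hw : LocallyIntegrableOn w (Ioi 0)) : Integrable (fun r => w r * κ r) := by
  have h1 : IntegrableOn w (Icc a b) := hw.integrableOn_compact_subset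
    (fun r hr => lt_of_lt_of_le h.2.1 hr.1) isCompact_Icc
  have h2 := h1.mul_continuousOn h.1.continuous.continuousOn isCompact_Icc
  refine (integrableOn_iff_integrable_of_support_subset fun r hr => ?_).1 h2
  by_contra hr'
  exact hr (by simp [h.2.2.2 r hr'])

theorem sub_const_mul {κ' : ℝ → ℝ} {a' b' : ℝ} (h : IsHalfLineTest κ a b) (h' : IsHalfLineTest κ' a' b')
    (c : ℝ) : IsHalfLineTest (fun r => κ r - c * κ' r) (min a a') (max b b') := by
  refine ⟨h.1.sub (contDiff_const.mul h'.1), lt_min h.2.1 h'.2.1,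
    lt_of_le_of_lt (min_le_left _ _) (lt_of_lt_of_le h.2.2.1 (le_max_left _ _)), fun r hr => ?_⟩
  simp only
  rw [h.2.2.2 r, h'.2.2.2 r, mul_zero, sub_zero]
  · exact fun hr' => hr ⟨(min_le_right _ _).trans hr'.1, hr'.2.trans (le_max_right _ _)⟩
  · exact fun hr' => hr ⟨(min_le_left _ _).trans hr'.1, hr'.2.trans (le_max_left _ _)⟩

/-- The smooth primitive of `κ` vanishing near `+∞`; it is constant near `0`. -/
theorem primitive (h : IsHalfLineTest κ a b) :
    ∃ g : ℝ → ℝ, ContDiff ℝ ∞ g ∧ (∀ r, HasDerivAt g (κ r) r) ∧ (∀ r, b ≤ r → g r = 0) ∧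
      ∀ r, r ≤ a → g r = -∫ s, κ s := by
  have hc := h.1.continuous
  have hd : ∀ r, HasDerivAt (fun r => ∫ s in b..r, κ s) (κ r) r := fun r =>
    intervalIntegral.integral_hasDerivAt_right (hc.intervalIntegrable _ _)
      (hc.stronglyMeasurableAtFilter _ _) hc.continuousAt
  refine ⟨fun r => ∫ s in b..r, κ s, ?_, hd, fun r hr => ?_, fun r hr => ?_⟩
  · refine contDiff_infty_iff_deriv.2 ⟨fun r => (hd r).differentiableAt, ?_⟩
    rw [show _root_.deriv (fun r => ∫ s in b..r, κ s) = κ from funext fun r => (hd r).deriv]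
    exact h.1
  · simp only [intervalIntegral.integral_of_le hr]
    refine setIntegral_eq_zero_of_forall_eq_zero fun s hs => h.2.2.2 s fun hs' => ?_
    exact absurd hs.1 (not_lt.2 hs'.2)
  · have hab := h.2.2.1
    simp only [intervalIntegral.integral_of_ge (hr.trans hab.le), neg_inj]
    rw [← integral_Icc_eq_integral_Ioc]
    refine setIntegral_eq_integral_of_forall_compl_eq_zero fun s hs => h.2.2.2 s fun hs' => hs ?_
    exact ⟨hr.trans hs'.1, hs'.2⟩

theorem exists_primitive (h : IsHalfLineTest κ a b) (h0 : ∫ s, κ s = 0) :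
    ∃ g : ℝ → ℝ, IsHalfLineTest g a b ∧ _root_.deriv g = κ := by
  obtain ⟨g, hg, hd, hb, ha⟩ := h.primitive
  refine ⟨g, ⟨hg, h.2.1, h.2.2.1, fun r hr => ?_⟩, funext fun r => (hd r).deriv⟩
  rcases lt_or_ge r a with h1 | h1
  · rw [ha r h1.le, h0, neg_zero]
  · exact hb r (le_of_not_ge fun h2 => hr ⟨h1, h2⟩)

theorem of_hasCompactSupport (h1 : ContDiff ℝ ∞ κ) (h2 : HasCompactSupport κ)
    (h3 : tsupport κ ⊆ Ioi 0) : ∃ a b, IsHalfLineTest κ a b := by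
  rcases (tsupport κ).eq_empty_or_nonempty with h0 | h0
  · refine ⟨1, 2, h1, one_pos, one_lt_two, fun r _ => image_eq_zero_of_notMem_tsupport ?_⟩
    simp [h0]
  · have hc : IsCompact (tsupport κ) := h2
    refine ⟨sInf (tsupport κ), sSup (tsupport κ) + 1, h1, h3 (hc.sInf_mem h0), ?_, fun r hr => ?_⟩
    · have := csInf_le_csSup h0 hc.bddBelow hc.bddAbove
      linarith
    · refine image_eq_zero_of_notMem_tsupport fun hr' => hr ⟨csInf_le hc.bddBelow hr', ?_⟩
      have := le_csSup hc.bddAbove hr'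
      linarith

theorem exists_integral_eq_one : ∃ (ρ : ℝ → ℝ) (a b : ℝ),
    IsHalfLineTest ρ a b ∧ ∫ r, ρ r = 1 := by
  let f : ContDiffBump (2 : ℝ) := ⟨1 / 2, 1, by norm_num, by norm_num⟩
  refine ⟨f.normed volume, 1, 3, ⟨f.contDiff_normed, one_pos, by norm_num, fun r hr => ?_⟩,
    f.integral_normed⟩
  have h1 : r ∉ Function.support (f.normed volume) := by
    rw [f.support_normed_eq, Real.ball_eq_Ioo]
    intro h2
    refine hr ⟨?_, ?_⟩
    · have := h2.1
      simp only [f] at this; linarith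
    · have := h2.2
      simp only [f] at this; linarith
  simpa using h1

end IsHalfLineTest

/-- **du Bois-Reymond lemma** on the half line: a locally integrable function whose distributional
derivative vanishes is constant. -/
theorem ae_eq_const_of_integral_mul_deriv_eq_zero {w : ℝ → ℝ}
    (hw : LocallyIntegrableOn w (Ioi 0))
    (h : ∀ κ a b, IsHalfLineTest κ a b → ∫ r, w r * deriv κ r = 0) :
    ∃ C : ℝ, ∀ᵐ r, r ∈ Ioi (0 : ℝ) → w r = C := by
  obtain ⟨ρ, aρ, bρ, hρ, hρ1⟩ := IsHalfLineTest.exists_integral_eq_one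
  set C := ∫ r, w r * ρ r with hC
  refine ⟨C, ?_⟩
  have hconst : LocallyIntegrableOn (fun _ : ℝ => C) (Ioi 0) :=
    (locallyIntegrable_const C).locallyIntegrableOn _
  have key := isOpen_Ioi.ae_eq_zero_of_integral_contDiff_smul_eq_zero (U := Ioi (0 : ℝ))
    (f := fun r => w r - C) (μ := volume) (hw.sub hconst) ?_
  · filter_upwards [key] with r hr h0 using sub_eq_zero.1 (hr h0)
  intro κ h1 h2 h3
  obtain ⟨a, b, hκ⟩ := IsHalfLineTest.of_hasCompactSupport h1 h2 h3
  -- `κ - (∫ κ) ρ` has mean zero, hence is a derivative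
  have hm := hκ.sub_const_mul hρ (∫ r, κ r)
  obtain ⟨g, hg, hgd⟩ := hm.exists_primitive (by
    rw [integral_sub hκ.integrable (hρ.integrable.const_mul _), integral_const_mul, hρ1]
    simp)
  have h4 := h g _ _ hg
  rw [hgd] at h4
  have h5 : ∀ r, w r * (κ r - (∫ r, κ r) * ρ r) = w r * κ r - (∫ r, κ r) * (w r * ρ r) :=
    fun r => by ring
  simp only [h5] at h4
  rw [integral_sub (hκ.integrable_mul hw) ((hρ.integrable_mul hw).const_mul _),
    integral_const_mul] at h4
  have h6 : ∀ r, κ r • (w r - C) = w r * κ r - C * κ r := fun r => by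
    simp only [smul_eq_mul]; ring
  simp only [h6]
  rw [integral_sub (hκ.integrable_mul hw) (hκ.integrable.const_mul _), integral_const_mul]
  linarith

end HalfLine
end MaxwellSchrodinger

namespace MaxwellSchrodinger

/-! ### Radial distributions on `ℝ³` -/

section Radial

open Set
open scoped ContDiff

/-- The radial Laplacian in the variable `s = |x| ^ 2`, which is smooth across the origin. -/
theorem laplacian_comp_norm_sq {G : ℝ → ℝ} (hG : ContDiff ℝ ∞ G) (x : E3) :
    Laplacian.laplacian (fun x : E3 => G (‖x‖ ^ 2)) x
      = 4 * ‖x‖ ^ 2 * deriv (deriv G) (‖x‖ ^ 2) + 6 * deriv G (‖x‖ ^ 2) := by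
  have hd1 : ∀ s, HasDerivAt G (deriv G s) s := fun s =>
    ((hG.differentiable (by simp)) s).hasDerivAt
  have hd2 : ∀ s, HasDerivAt (deriv G) (deriv (deriv G) s) s := fun s =>
    ((ContDiff.differentiable (n := ∞) hG.deriv' (by simp)) s).hasDerivAt
  have hn : ∀ y : E3, HasFDerivAt (fun y : E3 => ‖y‖ ^ 2) (2 • innerSL ℝ y) y := fun y =>
    (hasStrictFDerivAt_norm_sq y).hasFDerivAt
  have hs : ContDiff ℝ ∞ (fun y : E3 => G (‖y‖ ^ 2)) := hG.comp (contDiff_norm_sq ℝ)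
  have h1 : ∀ y e : E3, fderiv ℝ (fun x : E3 => G (‖x‖ ^ 2)) y e
      = 2 * deriv G (‖y‖ ^ 2) * ⟪y, e⟫ := by
    intro y e
    have h0 : HasFDerivAt (fun x : E3 => G (‖x‖ ^ 2)) _ y := (hd1 _).comp_hasFDerivAt y (hn y)
    rw [h0.fderiv]
    simp; ring
  have h2 : ∀ e : E3, fderiv ℝ (fderiv ℝ (fun x : E3 => G (‖x‖ ^ 2))) x e e
      = 4 * deriv (deriv G) (‖x‖ ^ 2) * ⟪x, e⟫ ^ 2 + 2 * deriv G (‖x‖ ^ 2) * ⟪e, e⟫ := by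
    intro e
    have hd : DifferentiableAt ℝ (fderiv ℝ (fun x : E3 => G (‖x‖ ^ 2))) x :=
      (hs.fderiv_right (m := ∞) (by norm_cast)).differentiable (by simp) x
    have h3 : fderiv ℝ (fun y => fderiv ℝ (fun x : E3 => G (‖x‖ ^ 2)) y e) x e
        = fderiv ℝ (fderiv ℝ (fun x : E3 => G (‖x‖ ^ 2))) x e e := by
      rw [fderiv_clm_apply hd (differentiableAt_const e)]
      simp
    rw [← h3]
    simp only [h1]
    have h4 : HasFDerivAt (fun y : E3 => deriv G (‖y‖ ^ 2)) _ x :=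
      (hd2 _).comp_hasFDerivAt x (hn x)
    have h5 : HasFDerivAt (fun y : E3 => ⟪y, e⟫) _ x :=
      (hasFDerivAt_id x).inner ℝ (hasFDerivAt_const e x)
    rw [((h4.const_mul 2).fun_mul h5).fderiv]
    simp
    ring
  rw [InnerProductSpace.laplacian_eq_iteratedFDeriv_orthonormalBasis _
    (EuclideanSpace.basisFun (Fin 3) ℝ)]
  simp only [iteratedFDeriv_two_apply, Matrix.cons_val_zero, Matrix.cons_val_one, h2]
  simp [Fin.sum_univ_three, EuclideanSpace.norm_sq_eq, EuclideanSpace.inner_single_right]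
  ring

theorem contDiff_comp_sqrt {g : ℝ → ℝ} {a c : ℝ} (hg : ContDiff ℝ ∞ g) (ha : 0 < a)
    (hc : ∀ r ≤ a, g r = c) : ContDiff ℝ ∞ (fun s => g (√s)) := by
  refine contDiff_iff_contDiffAt.2 fun s => ?_
  rcases lt_or_ge s (a ^ 2) with h | h
  · have : (fun s => g (√s)) =ᶠ[𝓝 s] fun _ => c := by
      filter_upwards [Iio_mem_nhds h] with t ht
      exact hc _ (Real.sqrt_le_iff.2 ⟨ha.le, le_of_lt ht⟩)
    exact contDiffAt_const.congr_of_eventuallyEq this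
  · exact hg.contDiffAt.comp s (Real.contDiffAt_sqrt (lt_of_lt_of_le (by positivity) h).ne')

/-- A radial test function `η(x) = g(|x|)` on `ℝ³` with prescribed flux `r² g'(r) = κ(r)`;
it is constant near the origin, and `r² Δη = κ'`. -/
theorem IsHalfLineTest.exists_radial_test {κ : ℝ → ℝ} {a b : ℝ} (h : IsHalfLineTest κ a b) :
    ∃ g L : ℝ → ℝ, IsTest (fun x : E3 => g ‖x‖) ∧ ContDiff ℝ ∞ g ∧
      (∀ r, HasDerivAt g (κ r / r ^ 2) r) ∧ (∀ r, b ≤ r → g r = 0) ∧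
      (∀ x : E3, Laplacian.laplacian (fun x : E3 => g ‖x‖) x = L ‖x‖) ∧
      ∀ r > 0, r ^ 2 * L r = _root_.deriv κ r := by
  have hk : IsHalfLineTest (fun r => κ r / r ^ 2) a b := by
    refine ⟨contDiff_iff_contDiffAt.2 fun r => ?_, h.2.1, h.2.2.1, fun r hr => ?_⟩
    · rcases lt_or_ge r a with h1 | h1
      · have : (fun r => κ r / r ^ 2) =ᶠ[𝓝 r] fun _ => 0 := by
          filter_upwards [Iio_mem_nhds h1] with t ht
          rw [h.2.2.2 t fun h' => absurd h'.1 (not_le.2 ht), zero_div]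
        exact contDiffAt_const.congr_of_eventuallyEq this
      · have : r ≠ 0 := (h.2.1.trans_le h1).ne'
        exact h.1.contDiffAt.div (contDiffAt_id.pow 2) (by simpa)
    · simp only
      rw [h.2.2.2 r hr, zero_div]
  obtain ⟨g, hg, hd, hb, ha⟩ := hk.primitive
  have hG := contDiff_comp_sqrt hg h.2.1 ha
  set G : ℝ → ℝ := fun s => g (√s) with hGdef
  have hgG : (fun x : E3 => g ‖x‖) = fun x : E3 => G (‖x‖ ^ 2) := by
    funext x
    simp [hGdef, Real.sqrt_sq (norm_nonneg x)]
  refine ⟨g, fun r => 4 * r ^ 2 * _root_.deriv (_root_.deriv G) (r ^ 2) +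
    6 * _root_.deriv G (r ^ 2), ⟨?_, ?_⟩, hg, hd, hb, fun x => ?_, fun r hr => ?_⟩
  · rw [hgG]
    exact hG.comp (contDiff_norm_sq ℝ)
  · refine HasCompactSupport.intro (isCompact_closedBall (0 : E3) b) fun x hx => hb _ ?_
    simp only [Metric.mem_closedBall, dist_zero_right, not_le] at hx
    exact hx.le
  · rw [hgG, laplacian_comp_norm_sq hG]
  · have hd1 : ∀ s, HasDerivAt G (_root_.deriv G s) s := fun s =>
      ((hG.differentiable (by simp)) s).hasDerivAt
    have hd2 : ∀ s, HasDerivAt (_root_.deriv G) (_root_.deriv (_root_.deriv G) s) s := fun s =>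
      ((ContDiff.differentiable (n := ∞) hG.deriv' (by simp)) s).hasDerivAt
    have hsq : ∀ t : ℝ, HasDerivAt (fun t : ℝ => t ^ 2) (2 * t) t := fun t => by
      simpa using hasDerivAt_pow 2 t
    have hκ : ∀ t > 0, κ t = 2 * t ^ 3 * _root_.deriv G (t ^ 2) := by
      intro t ht
      have h1 : HasDerivAt g (_root_.deriv G (t ^ 2) * (2 * t)) t := by
        refine ((hd1 (t ^ 2)).comp t (hsq t)).congr_of_eventuallyEq ?_
        filter_upwards [Ioi_mem_nhds ht] with x hx
        simp [hGdef, Real.sqrt_sq (le_of_lt hx)]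
      have h2 := h1.unique (hd t)
      field_simp at h2
      linarith
    have h3 : HasDerivAt κ (6 * r ^ 2 * _root_.deriv G (r ^ 2)
        + 2 * r ^ 3 * (_root_.deriv (_root_.deriv G) (r ^ 2) * (2 * r))) r := by
      have h4 : HasDerivAt (fun t : ℝ => 2 * t ^ 3) (6 * r ^ 2) r := by
        convert! (hasDerivAt_pow 3 r).const_mul (2 : ℝ) using 1
        norm_num; ring
      refine (h4.fun_mul ((hd2 (r ^ 2)).comp r (hsq r))).congr_of_eventuallyEq ?_
      filter_upwards [Ioi_mem_nhds hr] with x hx using hκ x hx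
    rw [h3.deriv]
    ring

theorem integral_radial (f : ℝ → ℝ) : ∫ x : E3, f ‖x‖ =
    (3 * volume.real (Metric.ball (0 : E3) 1)) * ∫ r in Ioi 0, r ^ 2 * f r := by
  rw [integral_fun_norm_addHaar]
  simp [mul_assoc]

theorem integrable_radial {f : ℝ → ℝ} : Integrable (fun x : E3 => f ‖x‖) ↔
    IntegrableOn (fun r => r ^ 2 * f r) (Ioi 0) := by
  rw [integrable_fun_norm_addHaar]
  simp

theorem ball_volume_pos : 0 < 3 * volume.real (Metric.ball (0 : E3) 1) := by
  have : 0 < volume.real (Metric.ball (0 : E3) 1) :=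
    ENNReal.toReal_pos (Metric.measure_ball_pos _ _ one_pos).ne' measure_ball_lt_top.ne
  positivity

theorem intervalIntegrable_of_locallyIntegrable_radial {F : ℝ → ℝ}
    (hF : LocallyIntegrable (fun x : E3 => F ‖x‖)) {R : ℝ} (hR : 0 ≤ R) :
    IntervalIntegrable (fun r => r ^ 2 * F r) volume 0 R := by
  have h1 : IntegrableOn (fun x : E3 => F ‖x‖) (Metric.ball 0 R) :=
    (hF.integrableOn_isCompact (isCompact_closedBall 0 R)).mono_set Metric.ball_subset_closedBall
  rw [integrableOn_fun_norm_addHaar] at h1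
  rw [intervalIntegrable_iff_integrableOn_Ioo_of_le hR]
  simpa using h1

theorem locallyIntegrableOn_of_locallyIntegrable_radial {F : ℝ → ℝ}
    (hF : LocallyIntegrable (fun x : E3 => F ‖x‖)) : LocallyIntegrableOn F (Ioi 0) := by
  have h1 : LocallyIntegrableOn (fun r => r ^ 2 * F r) (Ioi 0) := by
    rw [locallyIntegrableOn_iff isOpen_Ioi.isLocallyClosed]
    intro K hK hKc
    obtain ⟨R, hR⟩ := hKc.bddAbove
    have h2 := intervalIntegrable_of_locallyIntegrable_radial hF (le_max_left 0 R)
    rw [intervalIntegrable_iff_integrableOn_Ioc_of_le (le_max_left 0 R)] at h2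
    exact h2.mono_set fun r hr => ⟨hK hr, (hR hr).trans (le_max_right _ _)⟩
  have h2 := h1.continuousOn_mul (g := fun r : ℝ => (r ^ 2)⁻¹)
    (fun r hr => ((continuousAt_id.pow 2).inv₀ (by simpa using (ne_of_gt hr))).continuousWithinAt)
    isOpen_Ioi.isLocallyClosed
  rw [locallyIntegrableOn_iff isOpen_Ioi.isLocallyClosed] at h2 ⊢
  intro K hK hKc
  refine (h2 K hK hKc).congr_fun (fun r hr => ?_) hKc.measurableSet
  have : r ≠ 0 := (hK hr).ne'
  simp only
  field_simp

/-- The flux `∫₀ˢ P t² dt` of the radial density `P(|x|)` through the sphere of radius `s`, up to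
the factor `4π`. -/
noncomputable def flux (P : ℝ → ℝ) (s : ℝ) : ℝ := ∫ t in (0 : ℝ)..s, t ^ 2 * P t

theorem continuousOn_flux {P : ℝ → ℝ} (hP : LocallyIntegrable (fun x : E3 => P ‖x‖)) :
    ContinuousOn (flux P) (Ioi 0) := by
  intro r hr
  have hr : 0 < r := hr
  have h1 := intervalIntegrable_of_locallyIntegrable_radial hP (R := r + 1) (by linarith)
  have h2 := intervalIntegral.continuousOn_primitive_interval' h1 left_mem_uIcc
  rw [uIcc_of_le (by linarith)] at h2
  exact (h2.continuousAt (Icc_mem_nhds hr (by linarith))).continuousWithinAt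

/-- Integration by parts against the flux, which is absolutely continuous but in general not
differentiable everywhere. -/
theorem integral_flux_mul {P g k : ℝ → ℝ} (hP : LocallyIntegrable (fun x : E3 => P ‖x‖))
    {b : ℝ} (hb : 0 ≤ b) (hg : ContDiff ℝ ∞ g) (hgk : ∀ r, HasDerivAt g (k r) r)
    (hgb : g b = 0) :
    ∫ r in (0 : ℝ)..b, r ^ 2 * P r * g r = -∫ r in (0 : ℝ)..b, flux P r * k r := by
  have hi := intervalIntegrable_of_locallyIntegrable_radial hP hb
  have hA : AbsolutelyContinuousOnInterval (flux P) 0 b :=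
    hi.absolutelyContinuousOnInterval_intervalIntegral left_mem_uIcc
  have hgA : AbsolutelyContinuousOnInterval g 0 b :=
    ContDiffOn.absolutelyContinuousOnInterval (hg.of_le (by simp)).contDiffOn
  have h1 := hA.integral_mul_deriv_eq_deriv_mul hgA
  rw [show deriv g = k from funext fun r => (hgk r).deriv, hgb,
    show flux P 0 = 0 by simp [flux]] at h1
  rw [h1]
  simp only [mul_zero, zero_mul, sub_zero, zero_sub, neg_neg]
  refine intervalIntegral.integral_congr_ae ?_
  filter_upwards [hi.ae_hasDerivAt_integral] with r hr hr'
  rw [show deriv (flux P) r = r ^ 2 * P r from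
    (hr (uIoc_subset_uIcc hr') 0 left_mem_uIcc).deriv]

theorem hasDerivAt_integral_of_continuousOn {f : ℝ → ℝ} (hf : ContinuousOn f (Ioi 0)) {r : ℝ}
    (hr : 0 < r) : HasDerivAt (fun r => ∫ s in (1 : ℝ)..r, f s) (f r) r := by
  have hsub : uIcc 1 r ⊆ Ioi 0 := fun s hs => lt_of_lt_of_le (lt_min one_pos hr) hs.1
  exact intervalIntegral.integral_hasDerivAt_right (hf.mono hsub).intervalIntegrable
    (hf.stronglyMeasurableAtFilter isOpen_Ioi r hr) (hf.continuousAt (Ioi_mem_nhds hr))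

/-- A radial distributional solution of `ΔF = P` on `ℝ³` satisfies `r² F'(r) = ∫₀ʳ P s² ds` on
`(0, ∞)`. That the constant of integration in the flux vanishes is because the equation also holds
across the origin. -/
theorem ae_eq_of_laplacian_eq_radial {F P : ℝ → ℝ}
    (hF : LocallyIntegrable (fun x : E3 => F ‖x‖)) (hP : LocallyIntegrable (fun x : E3 => P ‖x‖))
    (h : ∀ η : E3 → ℝ, IsTest η →
      ∫ x, F ‖x‖ * Laplacian.laplacian η x = ∫ x, P ‖x‖ * η x) :
    ∃ C : ℝ, ∀ᵐ r, r ∈ Ioi (0 : ℝ) → F r = C + ∫ s in (1 : ℝ)..r, flux P s / s ^ 2 := by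
  have hB : ContinuousOn (fun s => flux P s / s ^ 2) (Ioi 0) :=
    (continuousOn_flux hP).div (by fun_prop) fun s hs => by simpa using (ne_of_gt hs)
  -- `B` is the solution with the right flux; `F - B` has zero distributional derivative
  set B : ℝ → ℝ := fun r => ∫ s in (1 : ℝ)..r, flux P s / s ^ 2 with hBdef
  have hBd : ∀ r > 0, HasDerivAt B (flux P r / r ^ 2) r := fun r hr =>
    hasDerivAt_integral_of_continuousOn hB hr
  have hBc : ContinuousOn B (Ioi 0) := fun r hr => (hBd r hr).continuousAt.continuousWithinAt
  have hBl : LocallyIntegrableOn B (Ioi 0) := hBc.locallyIntegrableOn measurableSet_Ioi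
  have hFl := locallyIntegrableOn_of_locallyIntegrable_radial hF
  have hdl : LocallyIntegrableOn (fun s => flux P s / s ^ 2) (Ioi 0) :=
    hB.locallyIntegrableOn measurableSet_Ioi
  suffices key : ∀ κ a b, IsHalfLineTest κ a b → ∫ r, (F r - B r) * deriv κ r = 0 by
    obtain ⟨C, hC⟩ := ae_eq_const_of_integral_mul_deriv_eq_zero (hFl.sub hBl) key
    refine ⟨C, ?_⟩
    filter_upwards [hC] with r hr h0
    have : F r - B r = C := hr h0
    linarith
  intro κ a b hκ
  have hF1 : ∫ r, F r * deriv κ r = -∫ r, flux P r / r ^ 2 * κ r := by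
    obtain ⟨g, L, hη, hg, hgd, hgb, hL, hLκ⟩ := hκ.exists_radial_test
    have h1 := h _ hη
    simp only [hL] at h1
    rw [integral_radial (fun r => F r * L r), integral_radial (fun r => P r * g r)] at h1
    have h2 := mul_left_cancel₀ ball_volume_pos.ne' h1
    have hb : 0 ≤ b := (hκ.2.1.trans hκ.2.2.1).le
    have h3 : ∫ r in Ioi (0 : ℝ), r ^ 2 * (F r * L r) = ∫ r, F r * deriv κ r := by
      rw [← hκ.deriv.setIntegral_mul F]
      refine setIntegral_congr_fun measurableSet_Ioi fun r hr => ?_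
      rw [← hLκ r hr]; ring
    have h4 : ∫ r in Ioi (0 : ℝ), r ^ 2 * (P r * g r)
        = ∫ r in (0 : ℝ)..b, r ^ 2 * P r * g r := by
      rw [intervalIntegral.integral_of_le hb]
      simp only [← mul_assoc]
      refine setIntegral_eq_of_subset_of_forall_sdiff_eq_zero measurableSet_Ioi
        Ioc_subset_Ioi_self fun r hr => ?_
      rw [hgb r (le_of_not_ge fun h' => hr.2 ⟨hr.1, h'⟩), mul_zero]
    have h5 : ∫ r in (0 : ℝ)..b, flux P r * (κ r / r ^ 2) = ∫ r, flux P r / r ^ 2 * κ r := by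
      rw [intervalIntegral.integral_of_le hb]
      simp only [mul_div_assoc', div_mul_eq_mul_div]
      refine setIntegral_eq_integral_of_forall_compl_eq_zero fun r hr => ?_
      rw [hκ.2.2.2 r fun h' => hr ⟨hκ.2.1.trans_le h'.1, h'.2⟩, mul_zero, zero_div]
    rw [← h3, h2, h4, integral_flux_mul hP hb hg hgd (hgb b le_rfl), h5]
  have hB1 : ∫ r, B r * deriv κ r = -∫ r, flux P r / r ^ 2 * κ r := by
    have hd : ∀ r, HasDerivAt (fun r => B r * κ r)
        (flux P r / r ^ 2 * κ r + B r * deriv κ r) r := by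
      intro r
      rcases lt_or_ge r a with h1 | h1
      · have h0 : (fun r => B r * κ r) =ᶠ[𝓝 r] fun _ => 0 := by
          filter_upwards [Iio_mem_nhds h1] with t ht
          rw [hκ.2.2.2 t fun h' => absurd h'.1 (not_le.2 ht), mul_zero]
        have h2 : r ∉ Icc a b := fun h' => absurd h'.1 (not_le.2 h1)
        rw [hκ.2.2.2 r h2, hκ.deriv.2.2.2 r h2, mul_zero, mul_zero, add_zero]
        exact (hasDerivAt_const r (0 : ℝ)).congr_of_eventuallyEq h0
      · exact (hBd r (hκ.2.1.trans_le h1)).fun_mul (hκ.hasDerivAt r)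
    have h0 := integral_eq_zero_of_hasDerivAt_of_integrable hd
      ((hκ.integrable_mul hdl).add (hκ.deriv.integrable_mul hBl)) (hκ.integrable_mul hBl)
    rw [integral_add (hκ.integrable_mul hdl) (hκ.deriv.integrable_mul hBl)] at h0
    linarith
  simp only [sub_mul]
  rw [integral_sub (hκ.deriv.integrable_mul hFl) (hκ.deriv.integrable_mul hBl), hF1, hB1, sub_self]

end Radial
end MaxwellSchrodinger

namespace MaxwellSchrodinger

/-! ### Radial profiles of a solution -/

section Profile

open Set

theorem flux_congr {P Q : ℝ → ℝ} (h : ∀ᵐ r, r ∈ Ioi (0 : ℝ) → P r = Q r) {s : ℝ} (hs : 0 ≤ s) :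
    flux P s = flux Q s := by
  refine intervalIntegral.integral_congr_ae ?_
  filter_upwards [h] with r hr hr'
  rw [uIoc_of_le hs] at hr'
  rw [hr hr'.1]

/-- The density is only assumed to agree almost everywhere with a continuous function `Q`. -/
theorem hasDerivAt_flux {P Q : ℝ → ℝ} (hP : LocallyIntegrable (fun x : E3 => P ‖x‖))
    (h : ∀ᵐ r, r ∈ Ioi (0 : ℝ) → P r = Q r) (hQ : ContinuousOn Q (Ioi 0)) {r : ℝ} (hr : 0 < r) :
    HasDerivAt (flux P) (r ^ 2 * Q r) r := by
  have hc : ContinuousOn (fun t => t ^ 2 * Q t) (Ioi 0) := (by fun_prop : ContinuousOn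
    (fun t : ℝ => t ^ 2) (Ioi 0)).mul hQ
  have hi : IntervalIntegrable (fun t => t ^ 2 * Q t) volume 0 r := by
    refine (intervalIntegrable_of_locallyIntegrable_radial hP hr.le).congr_ae ?_
    rw [uIoc_of_le hr.le, EventuallyEq, ae_restrict_iff' measurableSet_Ioc]
    filter_upwards [h] with t ht ht'
    rw [ht ht'.1]
  have hd : HasDerivAt (flux Q) (r ^ 2 * Q r) r :=
    intervalIntegral.integral_hasDerivAt_right hi
      (hc.stronglyMeasurableAtFilter isOpen_Ioi r hr) (hc.continuousAt (Ioi_mem_nhds hr))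
  refine hd.congr_of_eventuallyEq ?_
  filter_upwards [Ioi_mem_nhds hr] with t ht using flux_congr h (le_of_lt ht)

theorem ball_volume_eq : 3 * volume.real (Metric.ball (0 : E3) 1) = 4 * Real.pi := by
  rw [Measure.real, InnerProductSpace.volume_ball_of_dim_odd (k := 1) (by simp)]
  simp [Nat.doubleFactorial]
  rw [ENNReal.toReal_ofReal (by positivity)]
  ring

theorem not_integrableOn_Ioi_of_le {f : ℝ → ℝ} {R c : ℝ} (hR : 0 ≤ R) (hc : 0 < c)
    (hf : ∀ r ∈ Ioi R, c ≤ f r) : ¬ IntegrableOn f (Ioi 0) := by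
  intro h
  have h1 : IntegrableOn (fun _ : ℝ => c) (Ioi R) := by
    refine Integrable.mono' (h.mono_set (Ioi_subset_Ioi hR)) aestronglyMeasurable_const ?_
    filter_upwards [ae_restrict_mem measurableSet_Ioi] with r hr
    rw [Real.norm_of_nonneg hc.le]
    exact hf r hr
  rw [integrableOn_const_iff] at h1
  simp [hc.ne'] at h1

theorem ae_eq_zero_of_radial_profile {w : E3 → ℝ} {W : ℝ → ℝ} {n : ℕ} (hn : n ≠ 0)
    (hev : Even n) (hw : ∀ᵐ x, w x = W ‖x‖) (hint : Integrable (fun x => w x ^ n))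
    (h0 : ∀ᵐ r, r ∈ Ioi (0 : ℝ) → W r = 0) : w =ᵐ[volume] 0 := by
  have h1 : ∫ x, w x ^ n = 0 := by
    rw [integral_congr_ae (g := fun x => W ‖x‖ ^ n) (by filter_upwards [hw] with x hx; rw [hx]),
      integral_radial (fun r => W r ^ n)]
    refine mul_eq_zero_of_right _ (integral_eq_zero_of_ae ?_)
    rw [EventuallyEq, ae_restrict_iff' measurableSet_Ioi]
    filter_upwards [h0] with r hr hr'
    simp [hr hr', hn]
  rw [integral_eq_zero_iff_of_nonneg (fun x => hev.pow_nonneg _) hint] at h1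
  filter_upwards [h1] with x hx
  exact pow_eq_zero_iff hn |>.1 hx

theorem integrableOn_of_radial_profile {w : E3 → ℝ} {W W' : ℝ → ℝ} {n : ℕ}
    (hw : ∀ᵐ x, w x = W ‖x‖) (hint : Integrable (fun x => w x ^ n))
    (hW : ∀ᵐ r, r ∈ Ioi (0 : ℝ) → W r = W' r) :
    IntegrableOn (fun r => r ^ 2 * W' r ^ n) (Ioi 0) := by
  have h1 : Integrable (fun x : E3 => W ‖x‖ ^ n) :=
    hint.congr (by filter_upwards [hw] with x hx; rw [hx])
  refine (integrable_radial.1 h1 : IntegrableOn (fun r => r ^ 2 * W r ^ n) (Ioi 0)).congr ?_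
  rw [EventuallyEq, ae_restrict_iff' measurableSet_Ioi]
  filter_upwards [hW] with r hr hr'
  rw [hr hr']

/-- Newton's theorem for the potential: `φ'(r) = m(r) / r²`, where `m(r)` is the mass of `u²` in the
ball of radius `r`. -/
theorem IsSolution.exists_profile_phi {V u φ : E3 → ℝ} {N ω : ℝ} {U Φ : ℝ → ℝ}
    (hsol : IsSolution V N u φ ω) (hU : ∀ᵐ x, u x = U ‖x‖) (hΦ : ∀ᵐ x, φ x = Φ ‖x‖) :
    ∃ C : ℝ, ∀ᵐ r, r ∈ Ioi (0 : ℝ) →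
      Φ r = C + ∫ s in (1 : ℝ)..r, flux (fun t => 4 * Real.pi * U t ^ 2) s / s ^ 2 := by
  refine ae_eq_of_laplacian_eq_radial ?_ ?_ fun η hη => ?_
  · exact (locallyIntegrable_congr hΦ).1 hsol.locallyIntegrable_phi
  · refine (Integrable.congr (hsol.integrable_sq.const_mul (4 * Real.pi)) ?_).locallyIntegrable
    filter_upwards [hU] with x hx
    rw [hx]
  · have h1 := hsol.poisson η hη
    rw [← integral_const_mul] at h1
    convert! h1 using 1 <;> refine integral_congr_ae ?_
    · filter_upwards [hΦ] with x hx
      rw [hx]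
    · filter_upwards [hU] with x hx
      rw [hx, mul_assoc]

/-- The Schrödinger equation in flux form, `r² u'(r) = -∫₀ʳ 2 (ω + φ + z / t) u t² dt`. -/
theorem IsSolution.exists_profile_u {u φ : E3 → ℝ} {z N ω : ℝ} {U Φ : ℝ → ℝ}
    (hsol : IsSolution (coulomb z) N u φ ω) (hu : LocallyIntegrable u)
    (hU : ∀ᵐ x, u x = U ‖x‖) (hΦ : ∀ᵐ x, φ x = Φ ‖x‖) :
    LocallyIntegrable (fun x : E3 => -(2 * (ω + Φ ‖x‖ + z / ‖x‖) * U ‖x‖)) ∧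
    ∃ C : ℝ, ∀ᵐ r, r ∈ Ioi (0 : ℝ) →
      U r = C + ∫ s in (1 : ℝ)..r, flux (fun t => -(2 * (ω + Φ t + z / t) * U t)) s / s ^ 2 := by
  have hP : LocallyIntegrable (fun x : E3 => -(2 * (ω + Φ ‖x‖ + z / ‖x‖) * U ‖x‖)) := by
    refine (locallyIntegrable_congr ?_).1 (((hu.smul ω).add (hsol.locallyIntegrable_phi_mul.add
      hsol.locallyIntegrable_potential_mul)).smul (-2 : ℝ))
    filter_upwards [hU, hΦ] with x hx hx'
    simp only [Pi.smul_apply, Pi.add_apply, smul_eq_mul, coulomb, hx, hx']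
    ring
  refine ⟨hP, ae_eq_of_laplacian_eq_radial ((locallyIntegrable_congr hU).1 hu) hP
    fun η hη => ?_⟩
  have hi : ∀ w : E3 → ℝ, LocallyIntegrable w → Integrable (fun x => w x * η x) := fun w hw =>
    hw.integrable_smul_right_of_hasCompactSupport hη.1.continuous hη.2
  have h1 := hsol.schrodinger η hη
  have h0 : Integrable (fun x => φ x * u x * η x + coulomb z x * u x * η x) :=
    (hi _ hsol.locallyIntegrable_phi_mul).add (hi _ hsol.locallyIntegrable_potential_mul)
  have h2 : ∫ x : E3, -(2 * (ω + Φ ‖x‖ + z / ‖x‖) * U ‖x‖) * η x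
      = -2 * (ω * (∫ x, u x * η x) + ((∫ x, φ x * u x * η x)
        + ∫ x, coulomb z x * u x * η x)) := by
    rw [← integral_const_mul, ← integral_add (hi _ hsol.locallyIntegrable_phi_mul)
      (hi _ hsol.locallyIntegrable_potential_mul), ← integral_add ((hi _ hu).const_mul ω) h0,
      ← integral_const_mul]
    refine integral_congr_ae ?_
    filter_upwards [hU, hΦ] with x hx hx'
    simp only [coulomb, hx, hx']
    ring
  have h3 : ∫ x : E3, U ‖x‖ * Laplacian.laplacian η x = ∫ x, u x * Laplacian.laplacian η x := by
    refine integral_congr_ae ?_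
    filter_upwards [hU] with x hx
    rw [hx]
  rw [h2, h3]
  linarith

/-- The mass inside a ball is at most the total mass `N`. -/
theorem IsSolution.flux_le {V u φ : E3 → ℝ} {N ω : ℝ} {U : ℝ → ℝ}
    (hsol : IsSolution V N u φ ω) (hU : ∀ᵐ x, u x = U ‖x‖) {r : ℝ} (hr : 0 ≤ r) :
    flux (fun t => 4 * Real.pi * U t ^ 2) r ≤ N := by
  have h1 : N = ∫ t in Ioi 0, t ^ 2 * (4 * Real.pi * U t ^ 2) := by
    rw [← hsol.mass, integral_congr_ae (g := fun x => U ‖x‖ ^ 2)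
      (by filter_upwards [hU] with x hx; rw [hx]), integral_radial (fun t => U t ^ 2),
      ball_volume_eq, ← integral_const_mul]
    congr 1
    funext t
    ring
  rw [h1, flux, intervalIntegral.integral_of_le hr]
  have h2 := integrableOn_of_radial_profile hU hsol.integrable_sq (ae_of_all _ fun r _ => rfl)
  refine setIntegral_mono_set ?_ (ae_of_all _ fun t => by positivity)
    Ioc_subset_Ioi_self.eventuallyLE
  refine (h2.const_mul (4 * Real.pi)).congr (ae_of_all _ fun t => ?_)
  simp only
  ring

end Profile
end MaxwellSchrodinger

/-! ### Negativity of the frequency -/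

open MaxwellSchrodinger Set

theorem theorem1p3 (z N : ℝ) (hNz : N ≤ z)
    (u φ : MaxwellSchrodinger.E3 → ℝ) (ω : ℝ)
    (hu : MaxwellSchrodinger.MemH1 u)
    (hφ : MaxwellSchrodinger.MemD12 φ)
    (hu_rad : MaxwellSchrodinger.IsRadial u)
    (hφ_rad : MaxwellSchrodinger.IsRadial φ)
    (hsol : MaxwellSchrodinger.IsSolution (MaxwellSchrodinger.coulomb z) N u φ ω)
    (hne : ¬ (u =ᵐ[volume] 0 ∧ φ =ᵐ[volume] 0)) :
    ω < 0 := by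
  by_contra! hω
  obtain ⟨U, hU⟩ := hu_rad
  obtain ⟨Φ, hΦ⟩ := hφ_rad
  have hz : 0 ≤ z := by
    rw [← hsol.mass] at hNz
    exact (integral_nonneg fun x => sq_nonneg (u x)).trans hNz
  have hφ6 : Integrable (fun x => φ x ^ 6) := by
    refine (hφ.1.integrable_norm_pow (p := 6) (by norm_num)).congr (ae_of_all _ fun x => ?_)
    simp only [Real.norm_eq_abs]
    exact Even.pow_abs (by decide) _
  have huL : LocallyIntegrable u := hu.1.locallyIntegrable (by norm_num)
  obtain ⟨C, hC⟩ := hsol.exists_profile_phi hU hΦ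
  obtain ⟨hPu, D, hD⟩ := hsol.exists_profile_u huL hU hΦ
  have hPφ : LocallyIntegrable (fun x : E3 => 4 * Real.pi * U ‖x‖ ^ 2) := by
    refine (Integrable.congr (hsol.integrable_sq.const_mul (4 * Real.pi)) ?_).locallyIntegrable
    filter_upwards [hU] with x hx
    rw [hx]
  set Pφ : ℝ → ℝ := fun t => 4 * Real.pi * U t ^ 2 with hPφdef
  set Pu : ℝ → ℝ := fun t => -(2 * (ω + Φ t + z / t) * U t) with hPudef
  -- the classical representatives of the profiles
  set p : ℝ → ℝ := fun r => C + ∫ s in (1 : ℝ)..r, flux Pφ s / s ^ 2 with hpdef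
  set y : ℝ → ℝ := fun r => D + ∫ s in (1 : ℝ)..r, flux Pu s / s ^ 2
  have hdiv : ∀ {P : ℝ → ℝ}, LocallyIntegrable (fun x : E3 => P ‖x‖) →
      ContinuousOn (fun s => flux P s / s ^ 2) (Ioi 0) := fun hP =>
    (continuousOn_flux hP).div (by fun_prop) fun s hs => by simpa using (ne_of_gt hs)
  have hp : ∀ r ∈ Ioi (0 : ℝ), HasDerivAt p (flux Pφ r / r ^ 2) r := fun r hr =>
    (hasDerivAt_integral_of_continuousOn (hdiv hPφ) hr).const_add C
  have hy : ∀ r ∈ Ioi (0 : ℝ), HasDerivAt y (flux Pu r / r ^ 2) r := fun r hr =>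
    (hasDerivAt_integral_of_continuousOn (hdiv hPu) hr).const_add D
  set q : ℝ → ℝ := fun r => 2 * (ω + p r + z / r) with hqdef
  have hq : ∀ r ∈ Ioi (0 : ℝ), HasDerivAt q (2 * (flux Pφ r - z) / r ^ 2) r := by
    intro r hr
    have hr0 : r ≠ 0 := ne_of_gt hr
    convert! ((((hp r hr).const_add ω).fun_add
      ((hasDerivAt_const r z).fun_div (hasDerivAt_id r) hr0)).const_mul 2) using 1
    simp only [id]
    field_simp
    ring
  have hyc : ContinuousOn y (Ioi 0) := fun r hr => (hy r hr).continuousAt.continuousWithinAt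
  have hqc : ContinuousOn q (Ioi 0) := fun r hr => (hq r hr).continuousAt.continuousWithinAt
  have hPuq : ∀ᵐ r, r ∈ Ioi (0 : ℝ) → Pu r = -(q r * y r) := by
    filter_upwards [hC, hD] with r hr1 hr2 hr
    simp only [hPudef, hqdef]
    rw [hr1 hr, hr2 hr]
  have hflux : ∀ r ∈ Ioi (0 : ℝ), HasDerivAt (flux Pu) (r ^ 2 * -(q r * y r)) r := fun r hr =>
    hasDerivAt_flux hPu hPuq (hqc.mul hyc).neg hr
  have hq' : ∀ r ∈ Ioi (0 : ℝ), 2 * (flux Pφ r - z) / r ^ 2 ≤ 0 := fun r hr => by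
    have := hsol.flux_le hU (le_of_lt hr)
    exact div_nonpos_of_nonpos_of_nonneg (by linarith) (sq_nonneg r)
  have hp6 := integrableOn_of_radial_profile hΦ hφ6 hC
  -- `q` decreases, and a negative value of `q` would keep `p` away from `0` at infinity
  have hq0 : ∀ r ∈ Ioi (0 : ℝ), 0 ≤ q r := by
    intro r₀ hr₀
    by_contra! hneg
    have hanti : AntitoneOn q (Ioi 0) := by
      refine antitoneOn_of_hasDerivWithinAt_nonpos (convex_Ioi 0) hqc
        (fun r hr => (hq r (interior_subset hr)).hasDerivWithinAt)
        fun r hr => hq' r (interior_subset hr)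
    have hr₀' : 0 < r₀ := hr₀
    refine not_integrableOn_Ioi_of_le (R := r₀) (c := r₀ ^ 2 * (-q r₀ / 2) ^ 6) hr₀'.le
      (mul_pos (by positivity) (pow_pos (by linarith) 6)) (fun r hr => ?_) hp6
    have hr' : r₀ < r := hr
    have h1 := hanti hr₀ (mem_Ioi.2 (hr₀'.trans hr')) hr'.le
    have h2 : 0 ≤ z / r := div_nonneg hz (hr₀'.trans hr').le
    have h3 : -q r₀ / 2 ≤ -p r := by
      have h4 : q r = 2 * (ω + p r + z / r) := rfl
      linarith
    have h5 : (-q r₀ / 2) ^ 6 ≤ p r ^ 6 := by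
      rw [← Even.neg_pow (by decide : Even 6) (p r)]
      exact pow_le_pow_left₀ (by linarith) h3 6
    have h6 : r₀ ^ 2 ≤ r ^ 2 := pow_le_pow_left₀ hr₀'.le hr'.le 2
    exact mul_le_mul h6 h5 (by positivity) (by positivity)
  -- `v = r u` solves `v'' = -q v` and is square integrable
  have hv0 := eq_zero_of_deriv_eq_of_sq_integrable (v := fun r => r * y r)
    (v' := fun r => y r + flux Pu r / r) (q := q)
    (fun r hr => ?_) (fun r hr => ?_) hq hq' hq0 ?_
  rotate_left
  · have hr0 : r ≠ 0 := ne_of_gt hr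
    convert! (hasDerivAt_id r).fun_mul (hy r hr) using 1
    simp only [id]
    field_simp
  · have hr0 : r ≠ 0 := ne_of_gt hr
    convert! (hy r hr).fun_add ((hflux r hr).fun_div (hasDerivAt_id r) hr0) using 1
    simp only [id]
    field_simp
    ring
  · simp only [mul_pow]
    exact integrableOn_of_radial_profile hU hsol.integrable_sq hD
  have hU0 : ∀ᵐ r, r ∈ Ioi (0 : ℝ) → U r = 0 := by
    filter_upwards [hD] with r hr hr'
    rw [hr hr']
    exact (mul_eq_zero.1 (hv0 r hr')).resolve_left (ne_of_gt hr')
  refine hne ⟨ae_eq_zero_of_radial_profile two_ne_zero even_two hU hsol.integrable_sq hU0, ?_⟩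
  -- with `u = 0` the potential is constant, hence zero by integrability of `φ ^ 6`
  have hm0 : ∀ r ∈ Ioi (0 : ℝ), flux Pφ r = 0 := by
    intro r hr
    rw [flux_congr (Q := fun _ => 0) ?_ (le_of_lt hr)]
    · simp [flux]
    · filter_upwards [hU0] with t ht ht'
      simp [hPφdef, ht ht']
  have hpC : ∀ r ∈ Ioi (0 : ℝ), p r = C := by
    intro r hr
    simp only [hpdef, add_eq_left]
    rw [intervalIntegral.integral_congr (g := fun _ => 0), intervalIntegral.integral_zero]
    intro s hs
    have hs0 : s ∈ Ioi (0 : ℝ) := lt_of_lt_of_le (lt_min one_pos hr) hs.1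
    simp [hm0 s hs0]
  have hC0 : C = 0 := by
    by_contra hC0
    refine not_integrableOn_Ioi_of_le (R := 1) (c := C ^ 6) zero_le_one (by positivity)
      (fun r hr => ?_) hp6
    have hr1 : (1 : ℝ) < r := hr
    change C ^ 6 ≤ r ^ 2 * p r ^ 6
    rw [hpC r (mem_Ioi.2 (one_pos.trans hr1))]
    have h1 : 1 ≤ r ^ 2 := one_le_pow₀ hr1.le
    exact le_mul_of_one_le_left (by positivity) h1
  refine ae_eq_zero_of_radial_profile (by norm_num) (by decide) hΦ hφ6 ?_
  filter_upwards [hC] with r hr hr'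
  exact (hr hr').trans ((hpC r hr').trans hC0)
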